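/- Fix the computational basis of $\mathbb{C}^d$. A state is a positive semidefinite $d\times d$ complex matrix of trace $1$; it is incoherent if it is diagonal, and $\mathcal{I}$ is the set of incoherent states. Let $F(\rho,\sigma)=\bigl(\mathrm{Tr}\sqrt{\sqrt{\rho}\,\sigma\sqrt{\rho}}\bigr)^2$ be the fidelity, $D_{\min}(\rho\|\sigma)=-\log_2 F(\rho,\sigma)$ (with value $+\infty$ if $F(\rho,\sigma)=0$), and let $C_{\min}(\rho)=\min_{\delta\in\mathcal{I}}D_{\min}(\rho\|\delta)$ be the min-entropy of coherence. A completely positive trace-preserving (CPTP) map $\Lambda$ is a maximal incoherent operation (MIO) if $\Lambda(\delta)$ is incoherent for every incoherent $\delta$; it is an incoherent operation (IO) if $\Lambda(X)=\sum_n K_nXK_n^\dagger$ for finitely many Kraus operators $K_n$ such that, for every $n$ and every incoherent $\delta$ with $\mathrm{Tr}[K_n\delta K_n^\dagger]\neq 0$, the state $K_n\delta K_n^\dagger/\mathrm{Tr}[K_n\delta K_n^\dagger]$ is incoherent. The input and output dimensions of $\Lambda$ may differ. Theorem 1. For every state $\rho$ the minimum defining $C_{\min}(\rho)$ is attained and finite,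 and $C_{\min}$ is a coherence monotone satisfying the following. (C1) $C_{\min}(\rho)\ge 0$ for every state $\rho$, and $C_{\min}(\rho)=0$ if and only if $\rho$ is incoherent. (C2) $C_{\min}(\Lambda(\rho))\le C_{\min}(\rho)$ for every state $\rho$ and every MIO or IO map $\Lambda$. (C4) $C_{\min}\bigl(\sum_n p_n\rho_n\bigr)\le\sum_n p_n C_{\min}(\rho_n)$ for all finitely many states $\rho_n$ of the same dimension and all probability weights $p_n\ge 0$, $\sum_n p_n=1$. -/

import Mathlib

open scoped ComplexOrder MatrixOrder

noncomputable section

namespace Coherence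

/-- A quantum state of a `d`-dimensional system, as a density matrix in the computational basis. -/
def IsState {d : ℕ} (ρ : Matrix (Fin d) (Fin d) ℂ) : Prop :=
  ρ.PosSemidef ∧ ρ.trace = 1

/-- An incoherent state: a state that is diagonal in the computational basis. -/
def IsIncoherent {d : ℕ} (δ : Matrix (Fin d) (Fin d) ℂ) : Prop :=
  IsState δ ∧ δ.IsDiag

/-- The fidelity `F(ρ, σ) = (Tr √(√ρ σ √ρ))²`. -/
def fidelity {d : ℕ} (ρ σ : Matrix (Fin d) (Fin d) ℂ) : ℝ :=
  (CFC.sqrt (CFC.sqrt ρ * σ * CFC.sqrt ρ)).trace.re ^ 2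

/-- The min-divergence `D_min(ρ‖σ) = -log₂ F(ρ, σ)`, which is `+∞` when `F(ρ, σ) = 0`. -/
def dMin {d : ℕ} (ρ σ : Matrix (Fin d) (Fin d) ℂ) : EReal :=
  if fidelity ρ σ = 0 then ⊤ else ((-Real.logb 2 (fidelity ρ σ) : ℝ) : EReal)

/-- The min-entropy of coherence `C_min(ρ) = min_δ D_min(ρ‖δ)`, over the incoherent states `δ`,
as a real number. -/
def cMin {d : ℕ} (ρ : Matrix (Fin d) (Fin d) ℂ) : ℝ :=
  (sInf (dMin ρ '' {δ | IsIncoherent δ})).toReal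

/-- A linear map `Λ` between matrix spaces applied to each block of a block matrix: `id_k ⊗ Λ`. -/
def ampliation {d d' : ℕ} (k : ℕ) (Λ : Matrix (Fin d) (Fin d) ℂ →ₗ[ℂ] Matrix (Fin d') (Fin d') ℂ)
    (M : Matrix (Fin k × Fin d) (Fin k × Fin d) ℂ) :
    Matrix (Fin k × Fin d') (Fin k × Fin d') ℂ :=
  Matrix.of fun x y => Λ (Matrix.of fun i j => M (x.1, i) (y.1, j)) x.2 y.2

/-- A completely positive trace-preserving map. -/
def IsCPTP {d d' : ℕ} (Λ : Matrix (Fin d) (Fin d) ℂ →ₗ[ℂ] Matrix (Fin d') (Fin d') ℂ) : Prop :=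
  (∀ (k : ℕ) (M : Matrix (Fin k × Fin d) (Fin k × Fin d) ℂ),
    M.PosSemidef → (ampliation k Λ M).PosSemidef) ∧
  ∀ X : Matrix (Fin d) (Fin d) ℂ, (Λ X).trace = X.trace

/-- A maximal incoherent operation: a CPTP map that sends incoherent states to incoherent states. -/
def IsMIO {d d' : ℕ} (Λ : Matrix (Fin d) (Fin d) ℂ →ₗ[ℂ] Matrix (Fin d') (Fin d') ℂ) : Prop :=
  IsCPTP Λ ∧ ∀ δ : Matrix (Fin d) (Fin d) ℂ, IsIncoherent δ → IsIncoherent (Λ δ)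

/-- An incoherent operation: a CPTP map with a Kraus decomposition `Λ(X) = ∑ₙ Kₙ X Kₙ†` such that
every outcome `n` that occurs with nonzero probability `Tr (Kₙ δ Kₙ†)` on an incoherent state `δ`
leaves an incoherent state. -/
def IsIO {d d' : ℕ} (Λ : Matrix (Fin d) (Fin d) ℂ →ₗ[ℂ] Matrix (Fin d') (Fin d') ℂ) : Prop :=
  IsCPTP Λ ∧ ∃ (N : ℕ) (K : Fin N → Matrix (Fin d') (Fin d) ℂ),
    (∀ X : Matrix (Fin d) (Fin d) ℂ, Λ X = ∑ n, K n * X * (K n).conjTranspose) ∧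
    ∀ (n : Fin N) (δ : Matrix (Fin d) (Fin d) ℂ), IsIncoherent δ →
      (K n * δ * (K n).conjTranspose).trace ≠ 0 →
      IsIncoherent (((K n * δ * (K n).conjTranspose).trace)⁻¹ • (K n * δ * (K n).conjTranspose))

end Coherence

end

open scoped ComplexOrder MatrixOrder

/-! Everything rests on a variational form of the root fidelity: `rootFidelity ρ σ` is the largest
value of Re tr X over all X for which the block matrix [[ρ, X], [Xᴴ, σ]] is positive semidefinite.
`exists_block_posSemidef` attains it and `re_trace_le_rootFidelity` bounds it, both through polar
decompositions. Positivity of blocks survives CPTP maps and convex combinations. Hence the root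
fidelity grows under CPTP maps (`IsCPTP.rootFidelity_le`) and is jointly concave
(`sum_rootFidelity_le`). Compressing the block by (1, -1) shows that it is at most 1 on states, with
equality only when they coincide. The admissible blocks with incoherent σ form a compact set, so a
closest incoherent state δ exists, and `cMin ρ` is -2 log₂ of its root fidelity. C1 is then the
equality case, C2 tests with Λ(δ), and C4 tests with the mixture of the closest states and uses
concavity of log. -/

namespace Coherence

open Matrix

/-! ### Contractions, polar decomposition and trace bounds -/

section Blocks

variable {l m n : Type*} [Fintype l] [Fintype m] [Fintype n]
  [DecidableEq n]

/-- The block matrix with diagonal blocks `A`, `B` and off-diagonal blocks `X`, `Xᴴ`. -/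
abbrev block (A : Matrix m m ℂ) (X : Matrix m n ℂ) (B : Matrix n n ℂ) :
    Matrix (m ⊕ n) (m ⊕ n) ℂ :=
  fromBlocks A X Xᴴ B

/-- A rectangular matrix `V` with `Vᴴ V ≤ 1`. -/
def IsContraction (V : Matrix m n ℂ) : Prop := (1 - Vᴴ * V).PosSemidef

/-- 1 - VᴴV is the Schur complement of the upper left identity block. -/
theorem isContraction_iff_block [DecidableEq m] {V : Matrix m n ℂ} :
    IsContraction V ↔ (block 1 V 1).PosSemidef := by
  have : Invertible (1 : Matrix m m ℂ) := invertibleOne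
  rw [block, PosDef.fromBlocks₁₁ V 1 PosDef.one, inv_one, Matrix.mul_one]
  rfl

/-- The Schur complement of the other identity block is 1 - VVᴴ. -/
theorem IsContraction.conjTranspose [DecidableEq m] {V : Matrix m n ℂ} (h : IsContraction V) :
    IsContraction Vᴴ := by
  have : Invertible (1 : Matrix n n ℂ) := invertibleOne
  rw [isContraction_iff_block, block, PosDef.fromBlocks₂₂ _ V PosDef.one, inv_one,
    Matrix.mul_one] at h
  simpa [IsContraction] using h

theorem IsContraction.mul [DecidableEq m] {V : Matrix l m ℂ} {W : Matrix m n ℂ} (hV : IsContraction V)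
    (hW : IsContraction W) : IsContraction (V * W) := by
  have h := (PosSemidef.conjTranspose_mul_mul_same hV W).add hW
  rw [IsContraction]
  convert h using 1
  simp only [conjTranspose_mul, Matrix.mul_sub, Matrix.sub_mul, Matrix.mul_one, Matrix.mul_assoc]
  abel

/-- The Moore-Penrose inverse of a Hermitian matrix. -/
theorem exists_pseudoinverse {P : Matrix n n ℂ} (hP : P.IsHermitian) :
    ∃ Q : Matrix n n ℂ, Qᴴ = Q ∧ Q * P = P * Q ∧ Q * P * P = P := by
  have hPsa : IsSelfAdjoint P := hP
  have hc (f : ℝ → ℝ) : ContinuousOn f (spectrum ℝ P) :=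
    Set.Finite.continuousOn Matrix.finite_real_spectrum f
  have hid : cfc (fun x : ℝ => x) P = P := cfc_id' ℝ P
  -- Since 0⁻¹ = 0, this inverts P on its range and vanishes on its kernel; the spectrum is finite,
  -- so continuity is automatic.
  refine ⟨cfc (fun x : ℝ => x⁻¹) P, cfc_predicate (p := IsSelfAdjoint) (fun x : ℝ => x⁻¹) P,
    ?_, ?_⟩
  · have h := cfc_commute_cfc (fun x : ℝ => x⁻¹) (fun x : ℝ => x) P
    rw [hid] at h
    exact h
  · have h : cfc (fun x : ℝ => x⁻¹ * x * x) P = P := by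
      rw [← cfc_congr (f := fun x : ℝ => x) (g := fun x : ℝ => x⁻¹ * x * x), hid]
      intro x _
      by_cases hx : x = 0 <;> simp [hx]
    rw [cfc_mul _ _ _ (hc _) (hc _), cfc_mul _ _ _ (hc _) (hc _), hid] at h
    exact h

/-- **Polar decomposition**: if `Cᴴ C = P²` with `P` Hermitian then `C = V P` for a contraction `V`
with `Vᴴ C = P`. -/
theorem exists_polar (C : Matrix m n ℂ) {P : Matrix n n ℂ} (hP : P.IsHermitian)
    (h : Cᴴ * C = P * P) :
    ∃ V : Matrix m n ℂ, IsContraction V ∧ V * P = C ∧ Vᴴ * C = P := by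
  obtain ⟨Q, hQ, hQP, hQPP⟩ := exists_pseudoinverse hP
  have hidem : Q * P * (Q * P) = Q * P := by
    nth_rewrite 2 [hQP]
    rw [← Matrix.mul_assoc, hQPP, ← hQP]
  have hE : (1 - Q * P)ᴴ = 1 - Q * P := by
    rw [conjTranspose_sub, conjTranspose_mul, conjTranspose_one, hQ, hP.eq, hQP]
  -- QP is a self-adjoint projection with VᴴV = QP, and CᴴC = P² forces C to vanish on the range of
  -- 1 - QP.
  refine ⟨C * Q, ?_, ?_, ?_⟩
  · have hE2 : 1 - (C * Q)ᴴ * (C * Q) = (1 - Q * P)ᴴ * (1 - Q * P) := by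
      rw [hE, conjTranspose_mul, hQ, Matrix.mul_assoc, ← Matrix.mul_assoc Cᴴ, h, ← Matrix.mul_assoc,
        ← Matrix.mul_assoc, hQPP, Matrix.sub_mul, Matrix.one_mul, Matrix.mul_sub, hidem,
        Matrix.mul_one, sub_self, sub_zero, hQP]
    rw [IsContraction, hE2]
    exact posSemidef_conjTranspose_mul_self _
  · have h0 : C * (1 - Q * P) = 0 := by
      rw [← conjTranspose_mul_self_eq_zero, conjTranspose_mul, Matrix.mul_assoc,
        ← Matrix.mul_assoc Cᴴ, h, Matrix.mul_assoc P, Matrix.mul_sub, Matrix.mul_one,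
        ← Matrix.mul_assoc P Q, ← hQP, hQPP, sub_self, Matrix.mul_zero, Matrix.mul_zero]
    rw [Matrix.mul_sub, Matrix.mul_one, sub_eq_zero] at h0
    rw [Matrix.mul_assoc, ← h0]
  · rw [conjTranspose_mul, hQ, Matrix.mul_assoc, h, ← Matrix.mul_assoc, hQPP]

/-- 2 - K - Kᴴ = (1 - K)ᴴ(1 - K) + (1 - KᴴK) is positive semidefinite, so its trace against P is
nonnegative. -/
theorem re_trace_mul_le_of_isContraction {K P : Matrix n n ℂ} (hK : IsContraction K)
    (hP : P.PosSemidef) : (K * P).trace.re ≤ P.trace.re := by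
  obtain ⟨B, hB⟩ := CStarAlgebra.nonneg_iff_eq_star_mul_self.mp hP.nonneg
  rw [star_eq_conjTranspose] at hB
  have h1 : ((1 - K)ᴴ * (1 - K) + (1 - Kᴴ * K)).PosSemidef :=
    (posSemidef_conjTranspose_mul_self _).add hK
  have h2 := (h1.mul_mul_conjTranspose_same B).trace_nonneg
  have h3 : (B * ((1 - K)ᴴ * (1 - K) + (1 - Kᴴ * K)) * Bᴴ).trace
      = 2 * P.trace - (K * P).trace - star (K * P).trace := by
    have e : B * ((1 - K)ᴴ * (1 - K) + (1 - Kᴴ * K)) * Bᴴ =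
        (2 : ℂ) • (B * Bᴴ) - B * K * Bᴴ - (B * K * Bᴴ)ᴴ := by
      simp only [conjTranspose_sub, conjTranspose_mul, conjTranspose_one, conjTranspose_conjTranspose,
        Matrix.mul_sub, Matrix.sub_mul, Matrix.mul_add, Matrix.add_mul, Matrix.mul_one,
        Matrix.one_mul, Matrix.mul_assoc, two_smul]
      abel
    rw [e, trace_sub, trace_sub, trace_smul, trace_conjTranspose, trace_mul_cycle B K Bᴴ,
      trace_mul_comm B Bᴴ, ← hB, trace_mul_comm P K, smul_eq_mul]
  rw [h3] at h2
  have := (Complex.le_def.mp h2).1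
  simp at this
  linarith

/-- Entries of a Gram matrix are bounded by the mean of two diagonal entries (AM-GM). This supplies
boundedness for the compactness argument. -/
theorem PosSemidef.norm_apply_le {M : Matrix n n ℂ} (hM : M.PosSemidef) (i j : n) :
    ‖M i j‖ ≤ M.trace.re := by
  obtain ⟨B, hB⟩ := CStarAlgebra.nonneg_iff_eq_star_mul_self.mp hM.nonneg
  have hd (i : n) : (M i i).re = ∑ k, ‖B k i‖ ^ 2 := by
    rw [hB, star_eq_conjTranspose, mul_apply, Complex.re_sum]
    refine Finset.sum_congr rfl fun k _ => ?_
    rw [conjTranspose_apply, Complex.star_def, ← Complex.normSq_eq_conj_mul_self,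
      Complex.ofReal_re, Complex.normSq_eq_norm_sq]
  have ht (i : n) : (M i i).re ≤ M.trace.re := by
    rw [trace, Complex.re_sum]
    exact Finset.single_le_sum (f := fun i => (M.diag i).re)
      (fun k _ => (Complex.le_def.mp hM.diag_nonneg).1) (Finset.mem_univ i)
  have hn : ‖M i j‖ ≤ ∑ k, (‖B k i‖ ^ 2 + ‖B k j‖ ^ 2) / 2 := by
    rw [hB, star_eq_conjTranspose, mul_apply]
    refine (norm_sum_le _ _).trans (Finset.sum_le_sum fun k _ => ?_)
    rw [norm_mul, conjTranspose_apply, norm_star]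
    nlinarith [sq_nonneg (‖B k i‖ - ‖B k j‖)]
  rw [← Finset.sum_div, Finset.sum_add_distrib, ← hd, ← hd] at hn
  linarith [ht i, ht j]

end Blocks

/-- The set of positive semidefinite matrices is closed. -/
theorem isClosed_posSemidef {n : Type*} [Fintype n] : IsClosed {M : Matrix n n ℂ | M.PosSemidef} := by
  simp only [posSemidef_iff_dotProduct_mulVec, Set.ofPred_and, Set.ofPred_forall]
  refine IsClosed.inter (isClosed_eq (by fun_prop) (by fun_prop)) (isClosed_iInter fun x => ?_)
  exact isClosed_le continuous_const (by fun_prop)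

/-! ### Root fidelity as a maximum over positive blocks -/

/-- The square root `Tr √(√ρ σ √ρ)` of the fidelity. -/
noncomputable def rootFidelity {d : ℕ} (ρ σ : Matrix (Fin d) (Fin d) ℂ) : ℝ :=
  (CFC.sqrt (CFC.sqrt ρ * σ * CFC.sqrt ρ)).trace.re

variable {d d' : ℕ} {ρ σ : Matrix (Fin d) (Fin d) ℂ}

theorem rootFidelity_nonneg : 0 ≤ rootFidelity ρ σ :=
  (Complex.le_def.mp (CFC.sqrt_nonneg _).posSemidef.trace_nonneg).1

theorem fidelity_eq_sq : fidelity ρ σ = rootFidelity ρ σ ^ 2 := rfl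

theorem sqrt_isHermitian (A : Matrix (Fin d) (Fin d) ℂ) : (CFC.sqrt A)ᴴ = CFC.sqrt A :=
  (CFC.sqrt_nonneg A).posSemidef.1

theorem sqrt_conj_posSemidef (ρ : Matrix (Fin d) (Fin d) ℂ) (hσ : σ.PosSemidef) :
    (CFC.sqrt ρ * σ * CFC.sqrt ρ).PosSemidef := by
  have h := hσ.mul_mul_conjTranspose_same (CFC.sqrt ρ)
  rwa [sqrt_isHermitian] at h

theorem exists_polar_sqrt_mul_sqrt (ρ : Matrix (Fin d) (Fin d) ℂ) (hσ : σ.PosSemidef) :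
    ∃ V : Matrix (Fin d) (Fin d) ℂ, IsContraction V ∧
      V * CFC.sqrt (CFC.sqrt ρ * σ * CFC.sqrt ρ) = CFC.sqrt σ * CFC.sqrt ρ ∧
      Vᴴ * (CFC.sqrt σ * CFC.sqrt ρ) = CFC.sqrt (CFC.sqrt ρ * σ * CFC.sqrt ρ) := by
  refine exists_polar _ (sqrt_isHermitian _) ?_
  rw [CFC.sqrt_mul_sqrt_self _ (sqrt_conj_posSemidef ρ hσ).nonneg, conjTranspose_mul,
    sqrt_isHermitian, sqrt_isHermitian, Matrix.mul_assoc, ← Matrix.mul_assoc (CFC.sqrt σ),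
    CFC.sqrt_mul_sqrt_self σ hσ.nonneg, Matrix.mul_assoc]

theorem exists_block_posSemidef (hρ : ρ.PosSemidef) (hσ : σ.PosSemidef) :
    ∃ X, (block ρ X σ).PosSemidef ∧ X.trace.re = rootFidelity ρ σ := by
  obtain ⟨V, hV, -, hVP⟩ := exists_polar_sqrt_mul_sqrt ρ hσ
  -- The block is that of the contraction Vᴴ conjugated by diag(√ρ, √σ); cyclicity turns tr X into
  -- tr(Vᴴ√σ√ρ).
  refine ⟨CFC.sqrt ρ * Vᴴ * CFC.sqrt σ, ?_, ?_⟩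
  · have h := (isContraction_iff_block.mp hV.conjTranspose).conjTranspose_mul_mul_same
      (fromBlocks (CFC.sqrt ρ) 0 0 (CFC.sqrt σ))
    convert h using 1
    rw [block, block, fromBlocks_conjTranspose, fromBlocks_multiply, fromBlocks_multiply]
    simp [sqrt_isHermitian, CFC.sqrt_mul_sqrt_self ρ hρ.nonneg,
      CFC.sqrt_mul_sqrt_self σ hσ.nonneg, Matrix.mul_assoc]
  · rw [trace_mul_cycle, trace_mul_cycle, Matrix.mul_assoc, hVP]
    rfl

/-- Factor the block as BᴴB. The two column blocks of B are V₁√ρ and V₂√σ with contractions V₁, V₂,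
so tr X = tr(V₁ᴴV₂√σ√ρ), and polar decomposition of √σ√ρ leaves a contraction times √(√ρσ√ρ). -/
theorem re_trace_le_rootFidelity {X : Matrix (Fin d) (Fin d) ℂ} (h : (block ρ X σ).PosSemidef) :
    X.trace.re ≤ rootFidelity ρ σ := by
  have hρ : ρ.PosSemidef := h.submatrix Sum.inl
  have hσ : σ.PosSemidef := h.submatrix Sum.inr
  obtain ⟨B, hB⟩ := CStarAlgebra.nonneg_iff_eq_star_mul_self.mp h.nonneg
  have h₁ : B.toCols₁ᴴ * B.toCols₁ = CFC.sqrt ρ * CFC.sqrt ρ := by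
    rw [CFC.sqrt_mul_sqrt_self ρ hρ.nonneg]
    ext i j
    exact (congrFun₂ hB (Sum.inl i) (Sum.inl j)).symm
  have h₂ : B.toCols₂ᴴ * B.toCols₂ = CFC.sqrt σ * CFC.sqrt σ := by
    rw [CFC.sqrt_mul_sqrt_self σ hσ.nonneg]
    ext i j
    exact (congrFun₂ hB (Sum.inr i) (Sum.inr j)).symm
  have h₁₂ : X = B.toCols₁ᴴ * B.toCols₂ := by
    ext i j
    exact congrFun₂ hB (Sum.inl i) (Sum.inr j)
  obtain ⟨V₁, hV₁, e₁, -⟩ := exists_polar _ (sqrt_isHermitian ρ) h₁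
  obtain ⟨V₂, hV₂, e₂, -⟩ := exists_polar _ (sqrt_isHermitian σ) h₂
  obtain ⟨V, hV, e, -⟩ := exists_polar_sqrt_mul_sqrt ρ hσ
  have ht : X.trace = (V₁ᴴ * V₂ * V * CFC.sqrt (CFC.sqrt ρ * σ * CFC.sqrt ρ)).trace := by
    rw [h₁₂, ← e₁, ← e₂, conjTranspose_mul, sqrt_isHermitian, Matrix.mul_assoc _ V, e,
      Matrix.mul_assoc, trace_mul_comm]
    simp only [Matrix.mul_assoc]
  rw [ht]
  exact re_trace_mul_le_of_isContraction ((hV₁.conjTranspose.mul hV₂).mul hV)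
    (CFC.sqrt_nonneg _).posSemidef

theorem block_self_posSemidef (hρ : ρ.PosSemidef) : (block ρ ρ ρ).PosSemidef := by
  have h := hρ.submatrix (Sum.elim id id : Fin d ⊕ Fin d → Fin d)
  convert h using 1
  ext (i | i) (j | j) <;> simp [block, hρ.1.eq]

theorem sub_posSemidef_of_block {X : Matrix (Fin d) (Fin d) ℂ} (h : (block ρ X σ).PosSemidef) :
    (ρ - X - Xᴴ + σ).PosSemidef := by
  have h := h.conjTranspose_mul_mul_same (fromRows 1 (-1) : Matrix (Fin d ⊕ Fin d) (Fin d) ℂ)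
  convert h using 1
  rw [block, conjTranspose_fromRows_eq_fromCols_conjTranspose, fromCols_mul_fromBlocks,
    fromCols_mul_fromRows]
  simp
  abel

/-- With B₁, B₂ the column blocks of a Gram factor B, the hypothesis reads (B₁ - B₂)ᴴ(B₁ - B₂) = 0,
so B₁ = B₂. -/
theorem eq_of_block_of_sub_eq_zero {X : Matrix (Fin d) (Fin d) ℂ} (h : (block ρ X σ).PosSemidef)
    (h0 : ρ - X - Xᴴ + σ = 0) : ρ = σ := by
  obtain ⟨B, hB⟩ := CStarAlgebra.nonneg_iff_eq_star_mul_self.mp h.nonneg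
  have h₁ : B.toCols₁ᴴ * B.toCols₁ = ρ := by
    ext i j
    exact (congrFun₂ hB (Sum.inl i) (Sum.inl j)).symm
  have h₂ : B.toCols₂ᴴ * B.toCols₂ = σ := by
    ext i j
    exact (congrFun₂ hB (Sum.inr i) (Sum.inr j)).symm
  have h₁₂ : B.toCols₁ᴴ * B.toCols₂ = X := by
    ext i j
    exact (congrFun₂ hB (Sum.inl i) (Sum.inr j)).symm
  have hz : B.toCols₁ - B.toCols₂ = 0 := by
    rw [← conjTranspose_mul_self_eq_zero, conjTranspose_sub, Matrix.sub_mul, Matrix.mul_sub,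
      Matrix.mul_sub, h₁, h₂, h₁₂, ← h0, ← h₁₂, conjTranspose_mul, conjTranspose_conjTranspose]
    abel
  rw [← h₁, ← h₂, sub_eq_zero.mp hz]

theorem rootFidelity_le_one (hρ : IsState ρ) (hσ : IsState σ) : rootFidelity ρ σ ≤ 1 := by
  obtain ⟨X, hX, hr⟩ := exists_block_posSemidef hρ.1 hσ.1
  have h := (Complex.le_def.mp (sub_posSemidef_of_block hX).trace_nonneg).1
  rw [trace_add, trace_sub, trace_sub, hρ.2, hσ.2, trace_conjTranspose] at h
  simp at h
  linarith

theorem eq_of_rootFidelity_eq_one (hρ : IsState ρ) (hσ : IsState σ) (h1 : rootFidelity ρ σ = 1) :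
    ρ = σ := by
  obtain ⟨X, hX, hr⟩ := exists_block_posSemidef hρ.1 hσ.1
  refine eq_of_block_of_sub_eq_zero hX ((sub_posSemidef_of_block hX).trace_eq_zero_iff.mp ?_)
  rw [trace_add, trace_sub, trace_sub, hρ.2, hσ.2, trace_conjTranspose]
  apply Complex.ext <;> simp
  linarith

theorem rootFidelity_self (hρ : IsState ρ) : rootFidelity ρ ρ = 1 := by
  refine le_antisymm (rootFidelity_le_one hρ hρ) ?_
  have h := re_trace_le_rootFidelity (block_self_posSemidef hρ.1)
  rwa [hρ.2, Complex.one_re] at h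

/-! ### Monotonicity under CPTP maps and joint concavity -/

variable {Λ : Matrix (Fin d) (Fin d) ℂ →ₗ[ℂ] Matrix (Fin d') (Fin d') ℂ}

/-- The block is a positive element of M₂ ⊗ M_d, so 2-positivity of Λ applies; Hermiticity of the
image gives Λ(Xᴴ) = Λ(X)ᴴ. -/
theorem IsCPTP.posSemidef_block (hΛ : IsCPTP Λ) {X : Matrix (Fin d) (Fin d) ℂ}
    (h : (block ρ X σ).PosSemidef) : (block (Λ ρ) (Λ X) (Λ σ)).PosSemidef := by
  have h2 := (hΛ.1 2 _ (h.submatrix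
    fun x : Fin 2 × Fin d => if x.1 = 0 then Sum.inl x.2 else Sum.inr x.2)).submatrix
    (Sum.elim (fun i => (0, i)) (fun i => (1, i)) : Fin d' ⊕ Fin d' → Fin 2 × Fin d')
  have hX : Λ Xᴴ = (Λ X)ᴴ := by
    ext i j
    have := h2.1.apply (Sum.inr i) (Sum.inl j)
    exact this.symm
  convert h2 using 1
  ext (i | i) (j | j)
  · rfl
  · rfl
  · exact congrFun₂ hX.symm i j
  · rfl

theorem IsCPTP.isState (hΛ : IsCPTP Λ) (hρ : IsState ρ) : IsState (Λ ρ) := by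
  exact ⟨(hΛ.posSemidef_block (block_self_posSemidef hρ.1)).submatrix Sum.inl,
    (hΛ.2 ρ).trans hρ.2⟩

/-- The fidelity does not decrease under CPTP maps. -/
theorem IsCPTP.rootFidelity_le (hΛ : IsCPTP Λ) (hρ : IsState ρ) (hσ : IsState σ) :
    rootFidelity ρ σ ≤ rootFidelity (Λ ρ) (Λ σ) := by
  obtain ⟨X, hX, hr⟩ := exists_block_posSemidef hρ.1 hσ.1
  rw [← hr, ← hΛ.2 X]
  exact re_trace_le_rootFidelity (hΛ.posSemidef_block hX)

section Convex

variable {N : ℕ} {p : Fin N → ℝ} {ρs σs : Fin N → Matrix (Fin d) (Fin d) ℂ}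

/-- The square root of the fidelity is jointly concave. -/
theorem sum_rootFidelity_le (hp : ∀ n, 0 ≤ p n) (hρ : ∀ n, IsState (ρs n))
    (hσ : ∀ n, IsState (σs n)) :
    ∑ n, p n * rootFidelity (ρs n) (σs n) ≤ rootFidelity (∑ n, p n • ρs n) (∑ n, p n • σs n) := by
  choose X hX hr using fun n => exists_block_posSemidef (hρ n).1 (hσ n).1
  have h : (block (∑ n, p n • ρs n) (∑ n, p n • X n) (∑ n, p n • σs n)).PosSemidef := by
    have := posSemidef_sum (Finset.univ) (fun n _ => (hX n).smul (hp n))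
    convert this using 1
    ext (i | i) (j | j) <;> simp [block, Matrix.sum_apply]
  convert re_trace_le_rootFidelity h using 1
  simp [trace_sum, hr]

theorem isState_sum (hp : ∀ n, 0 ≤ p n) (h1 : ∑ n, p n = 1) (hρ : ∀ n, IsState (ρs n)) :
    IsState (∑ n, p n • ρs n) := by
  refine ⟨posSemidef_sum _ fun n _ => (hρ n).1.smul (hp n), ?_⟩
  simp only [trace_sum, trace_smul, (hρ _).2]
  rw [← Finset.sum_smul, h1, one_smul]

theorem isIncoherent_sum (hp : ∀ n, 0 ≤ p n) (h1 : ∑ n, p n = 1) (hρ : ∀ n, IsIncoherent (ρs n)) :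
    IsIncoherent (∑ n, p n • ρs n) := by
  refine ⟨isState_sum hp h1 fun n => (hρ n).1, fun i j hij => ?_⟩
  simp [Matrix.sum_apply, (hρ _).2 hij]

end Convex

/-! ### Existence of a closest incoherent state -/

/-- The positive semidefinite `2 × 2` block matrices with first diagonal block `ρ` and an
incoherent state as second diagonal block. -/
def incoherentBlocks (ρ : Matrix (Fin d) (Fin d) ℂ) :
    Set (Matrix (Fin d ⊕ Fin d) (Fin d ⊕ Fin d) ℂ) :=
  {M | M.PosSemidef ∧ M.toBlocks₁₁ = ρ ∧ M.toBlocks₂₂.trace = 1 ∧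
    ∀ i j, i ≠ j → M.toBlocks₂₂ i j = 0}

theorem isCompact_incoherentBlocks (hρ : IsState ρ) : IsCompact (incoherentBlocks ρ) := by
  have hcl : IsClosed (incoherentBlocks ρ) := by
    refine isClosed_posSemidef.inter (IsClosed.inter ?_ (IsClosed.inter ?_ ?_))
    · exact isClosed_eq (continuous_matrix fun i j => by simp only [toBlocks₁₁, of_apply]; fun_prop)
        continuous_const
    · refine isClosed_eq (Continuous.matrix_trace ?_) continuous_const
      exact continuous_matrix fun i j => by simp only [toBlocks₂₂, of_apply]; fun_prop
    · have h : IsClosed {M : Matrix (Fin d ⊕ Fin d) (Fin d ⊕ Fin d) ℂ |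
          ∀ i j, i ≠ j → M.toBlocks₂₂ i j = 0} := by
        simp only [Set.ofPred_forall]
        refine isClosed_iInter fun i => isClosed_iInter fun j => isClosed_iInter fun _ =>
          isClosed_eq ?_ continuous_const
        simp only [toBlocks₂₂, of_apply]
        fun_prop
      exact h
  refine IsCompact.of_isClosed_subset (isCompact_univ_pi fun _ => isCompact_univ_pi fun _ =>
    isCompact_closedBall (0 : ℂ) 2) hcl ?_
  rintro M ⟨hM, h₁, h₂, -⟩ i - j -
  have ht : M.trace = 2 := by
    rw [trace, Fintype.sum_sum_type]
    change M.toBlocks₁₁.trace + M.toBlocks₂₂.trace = 2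
    rw [h₁, h₂, hρ.2, one_add_one_eq_two]
  have h := PosSemidef.norm_apply_le hM i j
  rw [ht] at h
  simpa using h

theorem block_mem_incoherentBlocks {X : Matrix (Fin d) (Fin d) ℂ} (hσ : IsIncoherent σ)
    (h : (block ρ X σ).PosSemidef) : block ρ X σ ∈ incoherentBlocks ρ := by
  refine ⟨h, toBlocks_fromBlocks₁₁ _ _ _ _, ?_, ?_⟩
  · rw [toBlocks_fromBlocks₂₂, hσ.1.2]
  · rw [toBlocks_fromBlocks₂₂]
    exact fun i j hij => hσ.2 hij

theorem exists_eq_block_of_mem_incoherentBlocks {M : Matrix (Fin d ⊕ Fin d) (Fin d ⊕ Fin d) ℂ}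
    (hM : M ∈ incoherentBlocks ρ) :
    IsIncoherent M.toBlocks₂₂ ∧ (block ρ M.toBlocks₁₂ M.toBlocks₂₂).PosSemidef := by
  obtain ⟨h, h₁, h₂, h₃⟩ := hM
  refine ⟨⟨⟨h.submatrix Sum.inr, h₂⟩, fun i j hij => h₃ i j hij⟩, ?_⟩
  convert h using 1
  ext (i | i) (j | j)
  · exact (congrFun₂ h₁ i j).symm
  · rfl
  · exact h.1.apply (Sum.inr i) (Sum.inl j)
  · rfl

theorem IsState.ne_zero (hρ : IsState ρ) : d ≠ 0 := by
  rintro rfl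
  simpa using hρ.2

/-- The maximally mixed state. -/
theorem isIncoherent_maximallyMixed (hd : d ≠ 0) :
    IsIncoherent ((d : ℝ)⁻¹ • (1 : Matrix (Fin d) (Fin d) ℂ)) := by
  refine ⟨⟨PosSemidef.one.smul (by positivity), ?_⟩, fun i j hij => by simp [hij]⟩
  rw [trace_smul, trace_one, Fintype.card_fin, Complex.real_smul]
  have : (d : ℂ) ≠ 0 := by exact_mod_cast hd
  push_cast
  exact inv_mul_cancel₀ this

/-- Here √ρ(1/d)√ρ = ρ/d, so a zero value would force ρ = 0. This is what makes the minimum finite.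
-/
theorem rootFidelity_maximallyMixed_pos (hρ : IsState ρ) :
    0 < rootFidelity ρ ((d : ℝ)⁻¹ • (1 : Matrix (Fin d) (Fin d) ℂ)) := by
  have hδ := isIncoherent_maximallyMixed hρ.ne_zero
  refine rootFidelity_nonneg.lt_of_ne' fun h0 => ?_
  have hpsd := (CFC.sqrt_nonneg
    (CFC.sqrt ρ * ((d : ℝ)⁻¹ • (1 : Matrix (Fin d) (Fin d) ℂ)) * CFC.sqrt ρ)).posSemidef
  have htr := hpsd.trace_eq_zero_iff.mp
    (Complex.ext h0 (Complex.le_def.mp hpsd.trace_nonneg).2.symm)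
  rw [CFC.sqrt_eq_zero_iff _ (sqrt_conj_posSemidef ρ hδ.1.1).nonneg, Matrix.mul_smul, Matrix.mul_one,
    Matrix.smul_mul, CFC.sqrt_mul_sqrt_self ρ hρ.1.nonneg] at htr
  have hd : (d : ℝ)⁻¹ ≠ 0 := inv_ne_zero (Nat.cast_ne_zero.mpr hρ.ne_zero)
  have h1 := hρ.2
  rw [(smul_eq_zero.mp htr).resolve_left hd, trace_zero] at h1
  exact zero_ne_one h1

/-- Some incoherent state has maximal fidelity with `ρ`, and this fidelity is positive. -/
theorem exists_closest_incoherent (hρ : IsState ρ) :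
    ∃ δ, IsIncoherent δ ∧ 0 < rootFidelity ρ δ ∧
      ∀ σ, IsIncoherent σ → rootFidelity ρ σ ≤ rootFidelity ρ δ := by
  have hmix := isIncoherent_maximallyMixed hρ.ne_zero
  have hne : (incoherentBlocks ρ).Nonempty := by
    obtain ⟨X, hX, -⟩ := exists_block_posSemidef hρ.1 hmix.1.1
    exact ⟨_, block_mem_incoherentBlocks hmix hX⟩
  have hcont : Continuous fun M : Matrix (Fin d ⊕ Fin d) (Fin d ⊕ Fin d) ℂ =>
      M.toBlocks₁₂.trace.re := by
    refine Complex.continuous_re.comp (Continuous.matrix_trace ?_)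
    exact continuous_matrix fun i j => by simp only [toBlocks₁₂, of_apply]; fun_prop
  -- Maximizing the continuous function Re tr X jointly over X and σ avoids any continuity statement
  -- for the matrix square root.
  obtain ⟨M, hM, hmax⟩ := (isCompact_incoherentBlocks hρ).exists_isMaxOn hne hcont.continuousOn
  obtain ⟨hδ, hb⟩ := exists_eq_block_of_mem_incoherentBlocks hM
  have hle (σ) (hσ : IsIncoherent σ) : rootFidelity ρ σ ≤ rootFidelity ρ M.toBlocks₂₂ := by
    obtain ⟨X, hX, hr⟩ := exists_block_posSemidef hρ.1 hσ.1.1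
    rw [← hr]
    refine le_trans ?_ (re_trace_le_rootFidelity hb)
    have := hmax (block_mem_incoherentBlocks hσ hX)
    simpa [block, toBlocks_fromBlocks₁₂] using this
  exact ⟨_, hδ, (rootFidelity_maximallyMixed_pos hρ).trans_le (hle _ hmix), hle⟩

/-! ### The properties of the min-entropy of coherence -/

theorem dMin_of_pos (h : 0 < rootFidelity ρ σ) :
    dMin ρ σ = ((-2 * Real.logb 2 (rootFidelity ρ σ) : ℝ) : EReal) := by
  rw [dMin, fidelity_eq_sq, if_neg (pow_ne_zero 2 h.ne'), Real.logb_pow]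
  push_cast
  rw [neg_mul]

theorem logb_two_le {x y : ℝ} (hx : 0 < x) (hxy : x ≤ y) : Real.logb 2 x ≤ Real.logb 2 y :=
  Real.logb_le_logb_of_le one_lt_two hx hxy

theorem isLeast_dMin {δ : Matrix (Fin d) (Fin d) ℂ} (hδ : IsIncoherent δ)
    (hpos : 0 < rootFidelity ρ δ)
    (hmax : ∀ σ, IsIncoherent σ → rootFidelity ρ σ ≤ rootFidelity ρ δ) :
    IsLeast (dMin ρ '' {δ | IsIncoherent δ})
      ((-2 * Real.logb 2 (rootFidelity ρ δ) : ℝ) : EReal) := by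
  refine ⟨⟨δ, hδ, dMin_of_pos hpos⟩, ?_⟩
  rintro _ ⟨σ, hσ, rfl⟩
  rcases rootFidelity_nonneg (ρ := ρ) (σ := σ) |>.eq_or_lt with h | h
  · simp [dMin, fidelity_eq_sq, ← h]
  · rw [dMin_of_pos h]
    rw [EReal.coe_le_coe_iff]
    linarith [logb_two_le h (hmax σ hσ)]

theorem cMin_eq_of_isLeast {x : ℝ} (h : IsLeast (dMin ρ '' {δ | IsIncoherent δ}) (x : EReal)) :
    cMin ρ = x := by
  rw [cMin, h.csInf_eq, EReal.toReal_coe]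

theorem isLeast_cMin (hρ : IsState ρ) :
    IsLeast (dMin ρ '' {δ | IsIncoherent δ}) (cMin ρ : EReal) := by
  obtain ⟨δ, hδ, hpos, hmax⟩ := exists_closest_incoherent hρ
  have h := isLeast_dMin hδ hpos hmax
  rwa [cMin_eq_of_isLeast h]

theorem exists_cMin_eq (hρ : IsState ρ) :
    ∃ δ, IsIncoherent δ ∧ 0 < rootFidelity ρ δ ∧ cMin ρ = -2 * Real.logb 2 (rootFidelity ρ δ) := by
  obtain ⟨δ, hδ, hpos, hmax⟩ := exists_closest_incoherent hρ
  exact ⟨δ, hδ, hpos, cMin_eq_of_isLeast (isLeast_dMin hδ hpos hmax)⟩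

theorem cMin_le (hρ : IsState ρ) (hσ : IsIncoherent σ) (h : 0 < rootFidelity ρ σ) :
    cMin ρ ≤ -2 * Real.logb 2 (rootFidelity ρ σ) := by
  have := (isLeast_cMin hρ).2 ⟨σ, hσ, dMin_of_pos h⟩
  exact_mod_cast this

theorem cMin_nonneg (hρ : IsState ρ) : 0 ≤ cMin ρ := by
  obtain ⟨δ, hδ, hpos, h⟩ := exists_cMin_eq hρ
  have := logb_two_le hpos (rootFidelity_le_one hρ hδ.1)
  rw [Real.logb_one] at this
  linarith

theorem cMin_eq_zero_iff (hρ : IsState ρ) : cMin ρ = 0 ↔ IsIncoherent ρ := by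
  constructor
  · intro h0
    obtain ⟨δ, hδ, hpos, h⟩ := exists_cMin_eq hρ
    have h1 : Real.logb 2 (rootFidelity ρ δ) = 0 := by linarith
    have h2 : rootFidelity ρ δ = 1 :=
      Real.eq_one_of_pos_of_logb_eq_zero one_lt_two hpos h1
    rwa [eq_of_rootFidelity_eq_one hρ hδ.1 h2]
  · intro hi
    have hs := rootFidelity_self hρ
    have := cMin_le hρ hi (by rw [hs]; exact one_pos)
    rw [hs, Real.logb_one, mul_zero] at this
    exact le_antisymm this (cMin_nonneg hρ)

/-- The image of a closest incoherent state is an incoherent competitor for Λ(ρ), at least as close.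
-/
theorem cMin_map_le (hΛ : IsMIO Λ) (hρ : IsState ρ) : cMin (Λ ρ) ≤ cMin ρ := by
  obtain ⟨δ, hδ, hpos, h⟩ := exists_cMin_eq hρ
  have hle := hΛ.1.rootFidelity_le hρ hδ.1
  rw [h]
  refine (cMin_le (hΛ.1.isState hρ) (hΛ.2 δ hδ) (hpos.trans_le hle)).trans ?_
  linarith [logb_two_le hpos hle]

/-- Incoherent operations are maximal incoherent operations. -/
theorem IsIO.isMIO (hΛ : IsIO Λ) : IsMIO Λ := by
  obtain ⟨hc, N, K, hK, hinc⟩ := hΛ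
  refine ⟨hc, fun δ hδ => ⟨hc.isState hδ.1, ?_⟩⟩
  have hdiag (n : Fin N) : (K n * δ * (K n)ᴴ).IsDiag := by
    -- An outcome of probability zero has a positive semidefinite output of trace zero, hence zero.
    by_cases ht : (K n * δ * (K n)ᴴ).trace = 0
    · rw [(hδ.1.1.mul_mul_conjTranspose_same (K n)).trace_eq_zero_iff.mp ht]
      exact isDiag_zero
    · have h := ((hinc n δ hδ ht).2).smul (K n * δ * (K n)ᴴ).trace
      rwa [smul_smul, mul_inv_cancel₀ ht, one_smul] at h
  rw [hK]
  intro i j hij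
  rw [Matrix.sum_apply]
  exact Finset.sum_eq_zero fun n _ => hdiag n hij

/-- The mixture of the closest incoherent states is a competitor; joint concavity bounds its root
fidelity below, and Jensen for log finishes. Working with the root costs only the factor 2 before
the logarithm. -/
theorem cMin_convex {N : ℕ} {p : Fin N → ℝ} {ρs : Fin N → Matrix (Fin d) (Fin d) ℂ}
    (hp : ∀ n, 0 ≤ p n) (h1 : ∑ n, p n = 1) (hρ : ∀ n, IsState (ρs n)) :
    cMin (∑ n, p n • ρs n) ≤ ∑ n, p n * cMin (ρs n) := by
  choose δ hδ hpos h using fun n => exists_cMin_eq (hρ n)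
  have hle := sum_rootFidelity_le hp hρ (fun n => (hδ n).1)
  have hspos : 0 < ∑ n, p n * rootFidelity (ρs n) (δ n) :=
    (convex_Ioi (0 : ℝ)).sum_mem (fun n _ => hp n) h1 (fun n _ => hpos n)
  have hlog : ∑ n, p n * Real.log (rootFidelity (ρs n) (δ n)) ≤
      Real.log (∑ n, p n * rootFidelity (ρs n) (δ n)) :=
    strictConcaveOn_log_Ioi.concaveOn.le_map_sum (fun n _ => hp n) h1 (fun n _ => hpos n)
  have hlogb : ∑ n, p n * Real.logb 2 (rootFidelity (ρs n) (δ n)) ≤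
      Real.logb 2 (∑ n, p n * rootFidelity (ρs n) (δ n)) := by
    simp only [Real.logb, ← mul_div_assoc]
    rw [← Finset.sum_div]
    exact div_le_div_of_nonneg_right hlog (Real.log_pos one_lt_two).le
  refine (cMin_le (isState_sum hp h1 hρ) (isIncoherent_sum hp h1 hδ) (hspos.trans_le hle)).trans ?_
  have hsum : ∑ n, p n * cMin (ρs n) =
      -2 * ∑ n, p n * Real.logb 2 (rootFidelity (ρs n) (δ n)) := by
    rw [Finset.mul_sum]
    exact Finset.sum_congr rfl fun n _ => by rw [h]; ring
  rw [hsum]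
  linarith [logb_two_le hspos hle]

end Coherence

/-- The minimum that defines `C_min` is attained and finite on every state; `C_min` is nonnegative
and vanishes exactly on the incoherent states (C1), does not increase under MIO or IO maps (C2),
and is convex (C4). -/
theorem theorem1 :
    (∀ (d : ℕ) (ρ : Matrix (Fin d) (Fin d) ℂ), Coherence.IsState ρ →
      IsLeast (Coherence.dMin ρ '' {δ | Coherence.IsIncoherent δ})
        (Coherence.cMin ρ : EReal)) ∧
    (∀ (d : ℕ) (ρ : Matrix (Fin d) (Fin d) ℂ), Coherence.IsState ρ →
      0 ≤ Coherence.cMin ρ ∧ (Coherence.cMin ρ = 0 ↔ Coherence.IsIncoherent ρ)) ∧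
    (∀ (d d' : ℕ) (Λ : Matrix (Fin d) (Fin d) ℂ →ₗ[ℂ] Matrix (Fin d') (Fin d') ℂ),
      Coherence.IsMIO Λ ∨ Coherence.IsIO Λ →
      ∀ ρ : Matrix (Fin d) (Fin d) ℂ, Coherence.IsState ρ →
        Coherence.cMin (Λ ρ) ≤ Coherence.cMin ρ) ∧
    (∀ (d N : ℕ) (p : Fin N → ℝ) (ρ : Fin N → Matrix (Fin d) (Fin d) ℂ),
      (∀ n, 0 ≤ p n) → ∑ n, p n = 1 → (∀ n, Coherence.IsState (ρ n)) →
        Coherence.cMin (∑ n, p n • ρ n) ≤ ∑ n, p n * Coherence.cMin (ρ n)) := by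
  exact ⟨fun _ _ hρ => Coherence.isLeast_cMin hρ,
    fun _ _ hρ => ⟨Coherence.cMin_nonneg hρ, Coherence.cMin_eq_zero_iff hρ⟩,
    fun _ _ _ hΛ _ hρ => Coherence.cMin_map_le (hΛ.elim id Coherence.IsIO.isMIO) hρ,
    fun _ _ _ _ hp h1 hρ => Coherence.cMin_convex hp h1 hρ⟩
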